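/- Let $\mathcal X\subseteq\mathbb R^d$ be Lebesgue measurable, equipped with the $\sigma$-algebra of its Lebesgue-measurable subsets and with Lebesgue measure, and let $\|\cdot\|$ be a norm on $\mathbb R^d$. Let $\pi:\mathcal X\to[0,\infty)$ be a probability density (also denoting the corresponding distribution), let $\hat\pi:\mathcal X\to[0,\infty)$ be a measurable function with $\hat\pi(x)>0$ for $\pi$-almost all $x$, and let $q:\mathcal X\times\mathcal X\to[0,\infty)$ be a jointly measurable proposal density, $\int_{\mathcal X}q(x,y)\,dy=1$ for all $x\in\mathcal X$. Put $$r_{MH}(x,y)=\frac{\pi(y)q(y,x)}{\pi(x)q(x,y)},\qquad r_1(x,y)=\frac{\hat\pi(y)q(y,x)}{\hat\pi(x)q(x,y)},\qquad r_2(x,y)=\frac{\pi(y)/\hat\pi(y)}{\pi(x)/\hat\pi(x)},$$ with values in $[0,\infty]$ (where $a/0=\infty$ for $a>0$ and $0/0=0$), $\alpha_{MH}=1\wedge r_{MH}$ and $\alpha_{DA}=(1\wedge r_1)(1\wedge r_2)$. The Metropolis--Hastings (MH) kernel $P_{MH}$ and the delayed-acceptance (DA) kernel $P_{DA}$ are $$P(x,dy)=q(x,y)\,\alpha(x,y)\,dy+\Bigl[1-\int_{\mathcal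 X} q(x,z)\,\alpha(x,z)\,dz\Bigr]\delta_x(dy)$$ with $\alpha=\alpha_{MH}$ and $\alpha=\alpha_{DA}$ respectively. A kernel $P$ with stationary distribution $\pi$ is *variance bounding* if for every $f\in L^2(\pi)$ the asymptotic variance $\lim_{n\to\infty}n\,\mathrm{Var}\bigl[\frac1n\sum_{i=1}^nf(X_i)\bigr]$ exists and is finite, where $(X_i)_{i\ge1}$ is the Markov chain with kernel $P$ and $X_1\sim\pi$. Suppose that $q$ is *local*: for each $\epsilon>0$ there is an $r<\infty$ such that $\int_{\{y\in\mathcal X:\|y-x\|\ge r\}}q(x,y)\,dy<\epsilon$ for all $x\in\mathcal X$. Suppose also that there is a function $h:[0,\infty)\to[0,\infty)$, bounded on $[0,r]$ for every $r<\infty$, such that for $\pi$-almost all $x$ every $y\in\mathcal X$ with $q(x,y)>0$ and $|\log r_2(x,y)|>h(\|y-x\|)$ lies in $$\mathcal C(x)=\{y\in\mathcal X:\ \mathrm{sign}[\log r_1(x,y)]\ \mathrm{sign}[\log r_2(x,y)]\ge0\}$$ (with $\log0=-\infty$ and $\log\infty=\infty$). If $P_{MH}$ is variance bounding, then so is $P_{DA}$.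 -/

import Mathlib

open MeasureTheory ProbabilityTheory Filter Topology
open scoped NNReal ENNReal

namespace DelayedAcceptance

/-! ### The state space -/

/-- The points of `X ⊆ ℝ^d`, as a type of its own. It carries the σ-algebra of all
Lebesgue-measurable sets in `X` (and not the Borel σ-algebra). -/
def StateSpace {d : ℕ} (X : Set (EuclideanSpace ℝ (Fin d))) : Type :=
  {x : EuclideanSpace ℝ (Fin d) // x ∈ X}

namespace StateSpace

variable {d : ℕ} {X : Set (EuclideanSpace ℝ (Fin d))}

/-- The point of `ℝ^d` underlying a state. -/
def pt (x : StateSpace X) : EuclideanSpace ℝ (Fin d) := x.1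

/-- The inclusion of `X` in `ℝ^d`, where `ℝ^d` is equipped with its Lebesgue σ-algebra. -/
noncomputable def incl (x : StateSpace X) :
    NullMeasurableSpace (EuclideanSpace ℝ (Fin d)) volume := x.1

/-- The σ-algebra of Lebesgue-measurable subsets of `X`. -/
noncomputable instance instMeasurableSpace : MeasurableSpace (StateSpace X) :=
  MeasurableSpace.comap incl inferInstance

end StateSpace

/-- Lebesgue measure on the Lebesgue-measurable subsets of `X` (for Lebesgue-measurable `X`). -/
noncomputable def lebesgue {d : ℕ} (X : Set (EuclideanSpace ℝ (Fin d))) :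
    Measure (StateSpace X) :=
  Measure.comap StateSpace.incl
    (volume : Measure (EuclideanSpace ℝ (Fin d))).completion

instance instSigmaFiniteLebesgue {d : ℕ} (X : Set (EuclideanSpace ℝ (Fin d))) :
    SigmaFinite (lebesgue X) := by
  let S : ℕ → Set (EuclideanSpace ℝ (Fin d)) := spanningSets volume
  have hS : ∀ n, MeasurableSet (StateSpace.incl (X := X) ⁻¹' (S n)) := fun n =>
    ⟨S n, (measurableSet_spanningSets volume n).nullMeasurableSet, rfl⟩
  refine ⟨⟨⟨fun n => StateSpace.incl ⁻¹' (S n), fun _ => trivial, fun n => ?_, ?_⟩⟩⟩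
  · refine (Measure.comap_apply_le _ _ (hS n).nullMeasurableSet).trans_lt ?_
    refine (measure_mono (Set.image_preimage_subset _ _)).trans_lt ?_
    rw [Measure.completion_apply]
    exact measure_spanningSets_lt_top volume n
  · refine Set.eq_univ_of_forall fun x => Set.mem_iUnion.2 ?_
    have h : x.pt ∈ ⋃ n, S n := by
      rw [iUnion_spanningSets]
      trivial
    obtain ⟨n, hn⟩ := Set.mem_iUnion.1 h
    exact ⟨n, hn⟩

/-! ### Stationary Markov chains, asymptotic variance, variance bounding -/

section Chain

variable {α : Type*} [MeasurableSpace α]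

/-- `chainLaw P μ n` is the joint law of the first `n + 1` states of the Markov chain with
transition kernel `P` and initial law `μ`: given the states so far, the next state is
drawn from `P` at the last of them. -/
noncomputable def chainLaw (P : Kernel α α) (μ : Measure α) : (n : ℕ) → Measure (Fin (n + 1) → α)
  | 0 => μ.map (fun x _ => x)
  | n + 1 =>
      ((chainLaw P μ n) ⊗ₘ
        (P.comap (fun ω : Fin (n + 1) → α => ω (Fin.last n)) (measurable_pi_apply _))).map
        (fun p => (Fin.snoc p.1 p.2 : Fin (n + 2) → α))

/-- `n · Var[(1/n) ∑_{i=1}^n f(X_i)]` for the chain with kernel `P` started from `μ`, where the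
number of terms is `n = k + 1`. -/
noncomputable def scaledVariance (f : α → ℝ) (P : Kernel α α) (μ : Measure α) (k : ℕ) : ℝ :=
  ((k : ℝ) + 1) *
    variance (fun ω : Fin (k + 1) → α => (1 / ((k : ℝ) + 1)) * ∑ i, f (ω i)) (chainLaw P μ k)

/-- The asymptotic variance of `f` exists and is finite. -/
def HasFiniteAsymptoticVariance (f : α → ℝ) (P : Kernel α α) (μ : Measure α) : Prop :=
  ∃ v : ℝ, Tendsto (scaledVariance f P μ) atTop (𝓝 v)

/-- `P` is variance bounding: every `f ∈ L²(π)` has a finite asymptotic variance. -/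
def VarianceBounding (P : Kernel α α) (π : Measure α) : Prop :=
  ∀ f : α → ℝ, MemLp f 2 π → HasFiniteAsymptoticVariance f P π

/-! ### Propose-accept-reject kernels

Ratios are taken in `[0, ∞]`, with `a / 0 = ∞` for `a > 0` and `0 / 0 = 0`. -/

/-- The propose-accept-reject kernel
`P(x, dy) = q(x, y) a(x, y) dy + [1 - ∫ q(x, z) a(x, z) dz] δ_x(dy)` with proposal density `q`
(with respect to `vol`) and acceptance probability `a`. -/
noncomputable def parKernel (vol : Measure α) [SFinite vol] (q : α → α → ℝ≥0)
    (a : α → α → ℝ≥0∞) : Kernel α α :=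
  (Kernel.const α vol).withDensity (fun x y => (q x y : ℝ≥0∞) * a x y) +
    Kernel.id.withDensity (fun x _ => 1 - ∫⁻ z, (q x z : ℝ≥0∞) * a x z ∂vol)

/-- `r_MH(x, y) = π(y) q(y, x) / (π(x) q(x, y))`. -/
noncomputable def rMH (p : α → ℝ≥0) (q : α → α → ℝ≥0) (x y : α) : ℝ≥0∞ :=
  ((p y : ℝ≥0∞) * q y x) / ((p x : ℝ≥0∞) * q x y)

/-- `r_1(x, y) = π̂(y) q(y, x) / (π̂(x) q(x, y))`, the ratio of the screening stage. -/
noncomputable def rDA₁ (phat : α → ℝ≥0) (q : α → α → ℝ≥0) (x y : α) : ℝ≥0∞ :=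
  ((phat y : ℝ≥0∞) * q y x) / ((phat x : ℝ≥0∞) * q x y)

/-- `r_2(x, y) = (π(y) / π̂(y)) / (π(x) / π̂(x))`, the ratio of the correction stage. -/
noncomputable def rDA₂ (p phat : α → ℝ≥0) (x y : α) : ℝ≥0∞ :=
  ((p y : ℝ≥0∞) / phat y) / ((p x : ℝ≥0∞) / phat x)

/-- The Metropolis-Hastings kernel. -/
noncomputable def mhKernel (vol : Measure α) [SFinite vol] (p : α → ℝ≥0) (q : α → α → ℝ≥0) :
    Kernel α α :=
  parKernel vol q (fun x y => min 1 (rMH p q x y))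

/-- The delayed-acceptance kernel. -/
noncomputable def daKernel (vol : Measure α) [SFinite vol] (p phat : α → ℝ≥0)
    (q : α → α → ℝ≥0) : Kernel α α :=
  parKernel vol q (fun x y => min 1 (rDA₁ phat q x y) * min 1 (rDA₂ p phat x y))

/-- The log-error discrepancy `|log r_2(x, y)| ∈ [0, ∞]`. -/
noncomputable def logErrorDiscrepancy (p phat : α → ℝ≥0) (x y : α) : ℝ≥0∞ :=
  (ENNReal.log (rDA₂ p phat x y)).abs

/-- The 'no problem' set `C(x)`: the `y` for which `log r_1(x, y)` and `log r_2(x, y)` do not have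
strictly opposite signs. -/
noncomputable def noProblemSet (p phat : α → ℝ≥0) (q : α → α → ℝ≥0) (x : α) : Set α :=
  {y | 0 ≤ SignType.sign (ENNReal.log (rDA₁ phat q x y)) *
    SignType.sign (ENNReal.log (rDA₂ p phat x y))}

end Chain

/-- The distance `‖y - x‖` between two states, in the norm `N` on `ℝ^d`. -/
noncomputable def stateDist {d : ℕ} {X : Set (EuclideanSpace ℝ (Fin d))}
    (N : Seminorm ℝ (EuclideanSpace ℝ (Fin d))) (x y : StateSpace X) : ℝ≥0 :=
  ⟨N (y.pt - x.pt), apply_nonneg N _⟩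

/-- The proposal density `q` is local: for each `ε > 0` there is an `r` such that for all `x ∈ X`
the proposal from `x` falls outside the open ball `B(x, r)` with probability less than `ε`. -/
def IsLocal {d : ℕ} {X : Set (EuclideanSpace ℝ (Fin d))}
    (N : Seminorm ℝ (EuclideanSpace ℝ (Fin d))) (q : StateSpace X → StateSpace X → ℝ≥0) : Prop :=
  ∀ ε : ℝ≥0∞, 0 < ε → ∃ r : ℝ≥0, ∀ x : StateSpace X,
    ∫⁻ y in {y | stateDist N x y < r}ᶜ, (q x y : ℝ≥0∞) ∂(lebesgue X) < ε

end DelayedAcceptance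

/-!
For a reversible chain, variance bounding is equivalent to a right spectral gap, that is, to a
Poincaré inequality `c · Var_π f ≤ ∫ |f x - f y|² J(dx, dy)` for the flow `J` of accepted moves.
If all asymptotic variances are finite, then the variances of the sums of `N` terms, as quadratic
forms in `f`, are bounded by `K N ‖f‖²`, by uniform boundedness; on functions almost fixed by the
transition operator they would be of order `N²`, so there are none.

If `‖y - x‖ < r`, then either the two delayed-acceptance ratios lie on the same side of `1`, and
`α_DA = α_MH`, or `|log r₂| ≤ M` with `M` a bound for `h` on `[0, r]`, and `α_MH ≤ e^M α_DA`. So on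
such moves the Metropolis–Hastings flow is at most `e^M` times the delayed-acceptance flow. By
locality the remaining moves have probability at most `ε` from every state, so they contribute at
most `4 ε Var_π f`, which for small `ε` is absorbed by the spectral gap of Metropolis–Hastings.
-/

namespace DelayedAcceptance

/-! ### Self-adjoint contractions with a spectral gap -/

/-- The sum of `t ^ |i - j|` over all times `i, j < N`. When `t` is the transition operator of a
stationary reversible chain, `⟪f, pathSum t N f⟫` is the variance of `∑ i < N, f (X i)`. -/
def pathSum {R : Type*} [Semiring R] (t : R) (N : ℕ) : R :=
  ∑ i ∈ Finset.range N, ∑ j ∈ Finset.range N, t ^ Nat.dist i j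

theorem pathSum_succ {R : Type*} [Semiring R] (t : R) (N : ℕ) :
    pathSum t (N + 1) = pathSum t N + 2 * ∑ k ∈ Finset.range N, t ^ (k + 1) + 1 := by
  have hlast : ∑ i ∈ Finset.range N, t ^ Nat.dist i N = ∑ k ∈ Finset.range N, t ^ (k + 1) := by
    rw [← Finset.sum_range_reflect]
    refine Finset.sum_congr rfl fun i hi => congrArg (t ^ ·) ?_
    have := Finset.mem_range.1 hi
    simp only [Nat.dist]
    lia
  simp only [pathSum, Finset.sum_range_succ _ N, Finset.sum_add_distrib, Nat.dist_comm N,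
    Nat.dist_self, hlast, pow_zero, two_mul, add_assoc]

theorem one_sub_mul_pathSum_mul_one_sub {R : Type*} [Ring R] (t : R) (N : ℕ) :
    (1 - t) * pathSum t N * (1 - t) = N * (1 - t ^ 2) - 2 * (t - t ^ (N + 1)) := by
  have hgeom (n : ℕ) : (1 - t) * ∑ k ∈ Finset.range n, t ^ (k + 1) = t - t ^ (n + 1) := by
    simp only [pow_succ, ← Finset.sum_mul]
    rw [← mul_assoc, mul_neg_geom_sum, sub_mul, one_mul]
  induction N with
  | zero => simp [pathSum]
  | succ N ih =>
    calc (1 - t) * pathSum t (N + 1) * (1 - t)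
        = (1 - t) * pathSum t N * (1 - t) +
            2 * ((1 - t) * ∑ k ∈ Finset.range N, t ^ (k + 1)) * (1 - t) + (1 - t) * (1 - t) := by
          rw [pathSum_succ]; noncomm_ring
      _ = _ := by
          rw [ih, hgeom]; push_cast; noncomm_ring

section HilbertSpace

variable {H : Type*} [NormedAddCommGroup H]

theorem norm_apply_le_of_norm_le_one [NormedSpace ℝ H] {T : H →L[ℝ] H} (hT : ‖T‖ ≤ 1) (x : H) :
    ‖T x‖ ≤ ‖x‖ :=
  (T.le_of_opNorm_le hT x).trans_eq (one_mul _)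

theorem norm_pow_apply_le [NormedSpace ℝ H] {T : H →L[ℝ] H} (hT : ‖T‖ ≤ 1) (k : ℕ) (x : H) :
    ‖(T ^ k) x‖ ≤ ‖x‖ := by
  induction k with
  | zero => simp
  | succ k ih =>
    rw [pow_succ', mul_apply_eq_comp]
    exact (norm_apply_le_of_norm_le_one hT _).trans ih

theorem norm_pow_apply_sub_le [NormedSpace ℝ H] {T : H →L[ℝ] H} (hT : ‖T‖ ≤ 1) (k : ℕ) (x : H) :
    ‖(T ^ k) x - x‖ ≤ k * ‖T x - x‖ := by
  induction k with
  | zero => simp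
  | succ k ih =>
    have hstep : (T ^ (k + 1)) x - x = T ((T ^ k) x - x) + (T x - x) := by
      rw [pow_succ', mul_apply_eq_comp, map_sub]; abel
    calc ‖(T ^ (k + 1)) x - x‖ ≤ ‖(T ^ k) x - x‖ + ‖T x - x‖ := by
          rw [hstep]
          exact norm_add_le_of_le (norm_apply_le_of_norm_le_one hT _) le_rfl
      _ ≤ ((k + 1 : ℕ) : ℝ) * ‖T x - x‖ := by rw [Nat.cast_succ]; linarith

theorem norm_pathSum_apply_sub_le [NormedSpace ℝ H] {T : H →L[ℝ] H} (hT : ‖T‖ ≤ 1) (N : ℕ)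
    (x : H) : ‖pathSum T N x - ((N : ℝ) ^ 2) • x‖ ≤ (N : ℝ) ^ 3 * ‖T x - x‖ := by
  have hsum : pathSum T N x - ((N : ℝ) ^ 2) • x =
      ∑ i ∈ Finset.range N, ∑ j ∈ Finset.range N, ((T ^ Nat.dist i j) x - x) := by
    simp only [pathSum, sum_apply, Finset.sum_sub_distrib, Finset.sum_const, Finset.card_range,
      ← Nat.cast_smul_eq_nsmul ℝ, smul_smul, sq]
  have hterm {i j : ℕ} (hi : i ∈ Finset.range N) (hj : j ∈ Finset.range N) :
      ‖(T ^ Nat.dist i j) x - x‖ ≤ N * ‖T x - x‖ := by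
    refine (norm_pow_apply_sub_le hT _ x).trans ?_
    gcongr
    simp only [Finset.mem_range, Nat.dist] at *
    lia
  calc ‖pathSum T N x - ((N : ℝ) ^ 2) • x‖
      ≤ ∑ _i ∈ Finset.range N, ∑ _j ∈ Finset.range N, (N : ℝ) * ‖T x - x‖ :=
        hsum ▸ norm_sum_le_of_le _ fun _ hi => norm_sum_le_of_le _ fun _ hj => hterm hi hj
    _ = (N : ℝ) ^ 3 * ‖T x - x‖ := by
        simp only [Finset.sum_const, Finset.card_range, nsmul_eq_mul]; ring

variable [InnerProductSpace ℝ H]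

local notation "⟪" x ", " y "⟫" => inner ℝ x y

/-- The part of the spectrum of a self-adjoint contraction `T` near `1` is empty: `1 - T` is
bounded below by a positive constant, as a quadratic form. Nothing is asked near `-1`. -/
def HasSpectralGap (T : H →L[ℝ] H) : Prop :=
  ∃ c : ℝ, 0 < c ∧ ∀ x, c * ‖x‖ ^ 2 ≤ ‖x‖ ^ 2 - ⟪x, T x⟫

theorem hasSpectralGap_of_norm_le_mul {T : H →L[ℝ] H} (hT : ‖T‖ ≤ 1) {C : ℝ}
    (hC : ∀ x, ‖x‖ ≤ C * ‖T x - x‖) : HasSpectralGap T := by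
  refine ⟨1 / (2 * (C ^ 2 + 1)), by positivity, fun x => ?_⟩
  have hform : ‖T x - x‖ ^ 2 ≤ 2 * (‖x‖ ^ 2 - ⟪x, T x⟫) := by
    rw [norm_sub_rev, norm_sub_sq_real]
    nlinarith [norm_nonneg (T x), norm_apply_le_of_norm_le_one hT x]
  have hx : ‖x‖ ^ 2 ≤ C ^ 2 * ‖T x - x‖ ^ 2 := by
    rw [← mul_pow]
    exact pow_le_pow_left₀ (norm_nonneg _) (hC x) 2
  rw [one_div, inv_mul_le_iff₀ (by positivity)]
  nlinarith [sq_nonneg C, sq_nonneg ‖T x - x‖]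

variable [CompleteSpace H]

theorem isSelfAdjoint_pathSum {T : H →L[ℝ] H} (hT : IsSelfAdjoint T) (N : ℕ) :
    IsSelfAdjoint (pathSum T N) :=
  isSelfAdjoint_sum _ fun _ _ => isSelfAdjoint_sum _ fun _ _ => hT.pow _

theorem exists_forall_norm_le_of_forall_abs_inner_le {ι : Type*} {A : ι → H →L[ℝ] H}
    (hA : ∀ i, IsSelfAdjoint (A i)) (hb : ∀ x, ∃ C, ∀ i, |⟪x, A i x⟫| ≤ C) :
    ∃ C, ∀ i, ‖A i‖ ≤ C := by
  have hpol (i : ι) (x y : H) : ⟪A i x, y⟫ =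
      (⟪x + y, A i (x + y)⟫ - ⟪x - y, A i (x - y)⟫) / 4 := by
    have hsymm : ⟪y, A i x⟫ = ⟪x, A i y⟫ := by
      rw [real_inner_comm, (hA i).isSymmetric.apply_clm x y]
    rw [real_inner_comm]
    simp only [map_add, map_sub, inner_add_left, inner_add_right, inner_sub_left,
      inner_sub_right, hsymm]
    ring
  refine banach_steinhaus fun x => ?_
  suffices ∃ C, ∀ i, ‖innerSL ℝ (A i x)‖ ≤ C by simpa only [innerSL_apply_norm] using this
  refine banach_steinhaus fun y => ?_
  obtain ⟨C, hC⟩ := hb (x + y)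
  obtain ⟨D, hD⟩ := hb (x - y)
  refine ⟨(C + D) / 4, fun i => ?_⟩
  rw [innerSL_apply_apply, hpol, Real.norm_eq_abs, abs_div, abs_of_pos (four_pos (α := ℝ))]
  gcongr
  exact (abs_sub _ _).trans (add_le_add (hC i) (hD i))

theorem hasSpectralGap_of_abs_inner_pathSum_le {T : H →L[ℝ] H} (hT : IsSelfAdjoint T)
    (hT1 : ‖T‖ ≤ 1) (hb : ∀ x, ∃ C, ∀ N : ℕ, |⟪x, pathSum T N x⟫ / N| ≤ C) :
    HasSpectralGap T := by
  obtain ⟨K, hK⟩ : ∃ K, ∀ N : ℕ, ‖(N : ℝ)⁻¹ • pathSum T N‖ ≤ K :=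
    exists_forall_norm_le_of_forall_abs_inner_le
      (fun N => (IsSelfAdjoint.all _).smul (isSelfAdjoint_pathSum hT N))
      (by simpa only [smul_apply, real_inner_smul_right, div_eq_inv_mul] using hb)
  obtain ⟨N, hN⟩ := exists_nat_gt (K + 1)
  have hN0 : (0 : ℝ) < N := by linarith [(norm_nonneg _).trans (hK 0)]
  refine hasSpectralGap_of_norm_le_mul hT1 (C := (N : ℝ) ^ 2) fun x => ?_
  have hupper : ‖pathSum T N x‖ ≤ N * (K * ‖x‖) := by
    have := ContinuousLinearMap.le_of_opNorm_le _ (hK N) x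
    rwa [smul_apply, norm_smul, norm_inv, Real.norm_natCast, inv_mul_le_iff₀ hN0] at this
  have hlower : (N : ℝ) ^ 2 * ‖x‖ - N ^ 3 * ‖T x - x‖ ≤ ‖pathSum T N x‖ := by
    have h := (norm_sub_norm_le _ _).trans
      ((norm_sub_rev _ _).trans_le (norm_pathSum_apply_sub_le hT1 N x))
    rw [norm_smul, norm_pow, Real.norm_natCast] at h
    linarith
  have hcancel : (N - K) * ‖x‖ ≤ N ^ 2 * ‖T x - x‖ :=
    le_of_mul_le_mul_left (by linarith) hN0
  nlinarith [norm_nonneg x]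

theorem HasSpectralGap.surjective_one_sub {T : H →L[ℝ] H} (hgap : HasSpectralGap T) :
    Function.Surjective ⇑(1 - T) := by
  obtain ⟨c, hc, hgap⟩ := hgap
  let B : H →L[ℝ] H →L[ℝ] ℝ := (innerSL ℝ).comp (1 - T)
  have hB : IsCoercive B := ⟨c, hc, fun u => by
    have h : B u u = ‖u‖ ^ 2 - ⟪u, T u⟫ := by
      simp [B, real_inner_comm u (T u)]
    linarith [hgap u]⟩
  refine fun f => ⟨hB.continuousLinearEquivOfBilin.symm f, ext_inner_right ℝ fun w => ?_⟩
  rw [← hB.continuousLinearEquivOfBilin.apply_symm_apply f, hB.continuousLinearEquivOfBilin_apply]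
  simp only [B, ContinuousLinearEquiv.apply_symm_apply, ContinuousLinearMap.comp_apply,
    innerSL_apply_apply]

theorem HasSpectralGap.exists_tendsto {T : H →L[ℝ] H} (hT : IsSelfAdjoint T) (hT1 : ‖T‖ ≤ 1)
    (hgap : HasSpectralGap T) (f : H) :
    ∃ v : ℝ, Tendsto (fun N : ℕ => ⟪f, pathSum T N f⟫ / N) atTop (𝓝 v) := by
  obtain ⟨g, rfl⟩ := hgap.surjective_one_sub f
  have hform (N : ℕ) : ⟪(1 - T) g, pathSum T N ((1 - T) g)⟫ =
      N * ⟪g, g - (T ^ 2) g⟫ - 2 * ⟪g, T g - (T ^ (N + 1)) g⟫ := by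
    have happly : (1 - T) (pathSum T N ((1 - T) g)) =
        (N : ℝ) • (g - (T ^ 2) g) - (2 : ℝ) • (T g - (T ^ (N + 1)) g) := by
      have h := congrArg (fun A : H →L[ℝ] H => A g) (one_sub_mul_pathSum_mul_one_sub T N)
      simpa [← nsmul_eq_mul, Nat.cast_smul_eq_nsmul, two_mul, two_smul] using h
    rw [((IsSelfAdjoint.one (H →L[ℝ] H)).sub hT).isSymmetric.apply_clm, happly,
      inner_sub_right, real_inner_smul_right, real_inner_smul_right]
  have hbdd (N : ℕ) : |2 * ⟪g, T g - (T ^ (N + 1)) g⟫| ≤ 2 * (‖g‖ * (‖T g‖ + ‖g‖)) := by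
    rw [abs_mul, abs_two]
    gcongr
    refine (abs_real_inner_le_norm _ _).trans ?_
    gcongr
    exact norm_sub_le_of_le le_rfl (norm_pow_apply_le hT1 _ g)
  have hzero : Tendsto (fun N : ℕ => 2 * ⟪g, T g - (T ^ (N + 1)) g⟫ * (1 / (N : ℝ))) atTop (𝓝 0) :=
    bdd_le_mul_tendsto_zero' _ (.of_forall hbdd) tendsto_one_div_atTop_nhds_zero_nat
  refine ⟨⟪g, g - (T ^ 2) g⟫, ?_⟩
  rw [← sub_zero ⟪g, g - (T ^ 2) g⟫]
  refine (tendsto_const_nhds.sub hzero).congr' ?_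
  filter_upwards [eventually_ne_atTop 0] with N hN
  rw [hform]
  field_simp

end HilbertSpace

/-! ### The Markov chain and its transition operator -/

section MarkovStep

variable {Ω α : Type*} [MeasurableSpace Ω] [MeasurableSpace α] {μ : Measure Ω} {π : Measure α}
  {P : Kernel α α} [IsMarkovKernel P] {X : Ω → α}

theorem measurePreserving_fst_compProd [SFinite μ] (κ : Kernel Ω α) [IsMarkovKernel κ] :
    MeasurePreserving Prod.fst (μ ⊗ₘ κ) μ :=
  ⟨measurable_fst, Measure.fst_compProd μ κ⟩

theorem measurePreserving_snd_compProd_comap [SFinite μ] (hP : P.Invariant π)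
    (hX : MeasurePreserving X μ π) :
    MeasurePreserving Prod.snd (μ ⊗ₘ P.comap X hX.measurable) π := by
  refine ⟨measurable_snd, ?_⟩
  rw [← Measure.snd, Measure.snd_compProd]
  conv_rhs => rw [← hP.def, ← hX.map_eq]
  ext s hs
  rw [Measure.bind_apply hs (Kernel.aemeasurable _), Measure.bind_apply hs (Kernel.aemeasurable _),
    lintegral_map (Kernel.measurable_coe _ hs) hX.measurable]
  rfl

theorem measurePreserving_snd_compProd [SFinite π] (hP : P.Invariant π) :
    MeasurePreserving Prod.snd (π ⊗ₘ P) π :=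
  measurePreserving_snd_compProd_comap hP (.id π)

theorem isReversible_iff_measurePreserving_swap [IsFiniteMeasure π] :
    P.IsReversible π ↔ MeasurePreserving Prod.swap (π ⊗ₘ P) (π ⊗ₘ P) := by
  have hswap : MeasurePreserving Prod.swap (π ⊗ₘ P) (π ⊗ₘ P) ↔
      (π ⊗ₘ P).map Prod.swap = π ⊗ₘ P := ⟨fun h => h.map_eq, fun h => ⟨measurable_swap, h⟩⟩
  have hmap {A B : Set α} (hA : MeasurableSet A) (hB : MeasurableSet B) :
      (π ⊗ₘ P).map Prod.swap (A ×ˢ B) = ∫⁻ x in B, P x A ∂π := by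
    rw [Measure.map_apply measurable_swap (hA.prod hB), Set.preimage_swap_prod,
      Measure.compProd_apply_prod hB hA]
  rw [hswap, Measure.ext_prod_iff]
  refine ⟨fun h A B hA hB => ?_, fun h A B hA hB => ?_⟩
  · rw [hmap hA hB, Measure.compProd_apply_prod hA hB, h hA hB]
  · rw [← hmap hA hB, h hA hB, Measure.compProd_apply_prod hA hB]

theorem memLp_integral_kernel [IsFiniteMeasure π] (hP : P.Invariant π) {f : α → ℝ}
    (hf : MemLp f 2 π) : MemLp (fun x => ∫ y, f y ∂P x) 2 π := by
  have hf2 : MemLp (fun z : α × α => f z.2) 2 (π ⊗ₘ P) :=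
    hf.comp_measurePreserving (measurePreserving_snd_compProd hP)
  have hm : AEStronglyMeasurable (fun x => ∫ y, f y ∂P x) π := by
    simpa using hf2.1.integral_kernel_compProd
  have hsq := hf2.integrable_sq
  have hmean : Integrable (fun x => ∫ y, f y ^ 2 ∂P x) π := by
    simpa using hsq.integral_compProd
  refine (memLp_two_iff_integrable_sq hm).2 (hmean.mono' (hm.pow 2) ?_)
  filter_upwards [((Measure.integrable_compProd_iff hsq.1).1 hsq).1,
    hf2.1.ae_of_compProd (f := fun _ y => f y)] with x hx hxm
  have hvar := variance_nonneg f (P x)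
  rw [variance_eq_sub ((memLp_two_iff_integrable_sq hxm).2 hx)] at hvar
  rw [Real.norm_of_nonneg (sq_nonneg _)]
  exact sub_nonneg.1 hvar

theorem integral_mul_compProd_comap [IsFiniteMeasure μ] (hP : P.Invariant π)
    (hX : MeasurePreserving X μ π) {G : Ω → ℝ} (hG : MemLp G 2 μ) {f : α → ℝ}
    (hf : MemLp f 2 π) :
    ∫ z, G z.1 * f z.2 ∂(μ ⊗ₘ P.comap X hX.measurable) =
      ∫ ω, G ω * ∫ y, f y ∂P (X ω) ∂μ := by
  have hG' := hG.comp_measurePreserving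
    (measurePreserving_fst_compProd (P.comap X hX.measurable))
  have hf' := hf.comp_measurePreserving (measurePreserving_snd_compProd_comap hP hX)
  refine (Measure.integral_compProd (hG'.integrable_mul hf')).trans ?_
  simp only [Pi.mul_apply, Function.comp_apply, Kernel.comap_apply, integral_const_mul]

end MarkovStep

section MeanZero

variable {α : Type*} [MeasurableSpace α] {π : Measure α}

local notation "⟪" x ", " y "⟫" => inner ℝ x y

theorem real_inner_L2 (f g : Lp ℝ 2 π) : ⟪f, g⟫ = ∫ x, f x * g x ∂π := by
  simp only [L2.inner_def, RCLike.inner_apply, conj_trivial, mul_comm]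

/-- The mean-zero functions in `L²(π)`, on which a Markov operator can have a spectral gap. -/
noncomputable def meanZeroL2 (π : Measure α) [IsFiniteMeasure π] : Submodule ℝ (Lp ℝ 2 π) :=
  (ℝ ∙ indicatorConstLp 2 MeasurableSet.univ (measure_ne_top π _) (1 : ℝ))ᗮ

instance [IsFiniteMeasure π] : CompleteSpace (meanZeroL2 π) :=
  Submodule.instOrthogonalCompleteSpace _

theorem mem_meanZeroL2 [IsFiniteMeasure π] {f : Lp ℝ 2 π} :
    f ∈ meanZeroL2 π ↔ ∫ x, f x ∂π = 0 := by
  rw [meanZeroL2, Submodule.mem_orthogonal_singleton_iff_inner_right,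
    L2.inner_indicatorConstLp_one, setIntegral_univ]

variable [IsProbabilityMeasure π]

/-- The class of `f - ∫ f dπ` in the space of mean-zero functions. -/
noncomputable def center {f : α → ℝ} (hf : MemLp f 2 π) : meanZeroL2 π :=
  ⟨(hf.sub (memLp_const (∫ x, f x ∂π))).toLp _, by
    rw [mem_meanZeroL2, integral_congr_ae (hf.sub (memLp_const (∫ x, f x ∂π))).coeFn_toLp]
    simp [integral_sub (hf.integrable one_le_two) (integrable_const _)]⟩

theorem coeFn_center {f : α → ℝ} (hf : MemLp f 2 π) :
    ⇑(center hf : Lp ℝ 2 π) =ᵐ[π] fun x => f x - ∫ x, f x ∂π :=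
  (hf.sub (memLp_const (∫ x, f x ∂π))).coeFn_toLp

theorem center_coe (f : meanZeroL2 π) : center (Lp.memLp (f : Lp ℝ 2 π)) = f := by
  refine Subtype.ext (Lp.ext ?_)
  filter_upwards [coeFn_center (Lp.memLp (f : Lp ℝ 2 π))] with x hx
  rw [hx, mem_meanZeroL2.1 f.2, sub_zero]

end MeanZero

section TransitionOperator

variable {α : Type*} [MeasurableSpace α] {π : Measure α} [IsProbabilityMeasure π]
  {P : Kernel α α} [IsMarkovKernel P]

local notation "⟪" x ", " y "⟫" => inner ℝ x y

variable (π P) in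
/-- The isometry `f ↦ f(X₁)` into `L²` of the joint law of two successive states `X₁, X₂`. -/
noncomputable def embedFst : meanZeroL2 π →ₗᵢ[ℝ] Lp ℝ 2 (π ⊗ₘ P) :=
  (Lp.compMeasurePreservingₗᵢ ℝ Prod.fst (measurePreserving_fst_compProd P)).comp
    (meanZeroL2 π).subtypeₗᵢ

/-- The isometry `f ↦ f(X₂)` into `L²` of the joint law of two successive states `X₁, X₂`. -/
noncomputable def embedSnd (hP : P.Invariant π) : meanZeroL2 π →ₗᵢ[ℝ] Lp ℝ 2 (π ⊗ₘ P) :=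
  (Lp.compMeasurePreservingₗᵢ ℝ Prod.snd (measurePreserving_snd_compProd hP)).comp
    (meanZeroL2 π).subtypeₗᵢ

/-- The transition operator `f ↦ ∫ f(y) P(·, dy)` on mean-zero functions. It is encoded as the
operator that represents the form `(g, f) ↦ E[g(X₁) f(X₂)]`. -/
noncomputable def transitionOp (hP : P.Invariant π) : meanZeroL2 π →L[ℝ] meanZeroL2 π :=
  (embedFst π P).toContinuousLinearMap.adjoint ∘L (embedSnd hP).toContinuousLinearMap

theorem coeFn_embedFst (f : meanZeroL2 π) :
    embedFst π P f =ᵐ[π ⊗ₘ P] fun z => (f : Lp ℝ 2 π) z.1 :=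
  Lp.coeFn_compMeasurePreserving _ _

theorem coeFn_embedSnd (hP : P.Invariant π) (f : meanZeroL2 π) :
    embedSnd hP f =ᵐ[π ⊗ₘ P] fun z => (f : Lp ℝ 2 π) z.2 :=
  Lp.coeFn_compMeasurePreserving _ _

theorem inner_transitionOp_right (hP : P.Invariant π) (f g : meanZeroL2 π) :
    ⟪g, transitionOp hP f⟫ = ⟪embedFst π P g, embedSnd hP f⟫ := by
  rw [transitionOp, ContinuousLinearMap.comp_apply, ContinuousLinearMap.adjoint_inner_right,
    LinearIsometry.coe_toContinuousLinearMap, LinearIsometry.coe_toContinuousLinearMap]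

theorem inner_transitionOp_right_eq_integral (hP : P.Invariant π) (f g : meanZeroL2 π) :
    ⟪g, transitionOp hP f⟫ = ∫ z, (g : Lp ℝ 2 π) z.1 * (f : Lp ℝ 2 π) z.2 ∂(π ⊗ₘ P) := by
  rw [inner_transitionOp_right, real_inner_L2]
  exact integral_congr_ae ((coeFn_embedFst g).mul (coeFn_embedSnd hP f))

theorem norm_transitionOp_le_one (hP : P.Invariant π) : ‖transitionOp hP‖ ≤ 1 := by
  refine (ContinuousLinearMap.opNorm_comp_le _ _).trans
    (mul_le_one₀ ?_ (by positivity) (embedSnd hP).norm_toContinuousLinearMap_le)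
  rw [LinearIsometryEquiv.norm_map]
  exact (embedFst π P).norm_toContinuousLinearMap_le

theorem coeFn_transitionOp (hP : P.Invariant π) (f : meanZeroL2 π) :
    ⇑(transitionOp hP f : Lp ℝ 2 π) =ᵐ[π] fun x => ∫ y, (f : Lp ℝ 2 π) y ∂P x := by
  have hf := Lp.memLp (f : Lp ℝ 2 π)
  have hPf := memLp_integral_kernel hP hf
  have hmean : ∫ x, ∫ y, (f : Lp ℝ 2 π) y ∂P x ∂π = 0 := by
    have h := integral_mul_compProd_comap hP (.id π) (memLp_const (1 : ℝ)) hf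
    simp only [one_mul, id_eq] at h
    rw [← h, ← mem_meanZeroL2.1 f.2]
    exact (measurePreserving_snd_compProd hP).hasLaw.integral_comp hf.1
  suffices transitionOp hP f = center hPf by
    rw [this]
    simpa only [hmean, sub_zero] using coeFn_center hPf
  refine ext_inner_left ℝ fun g => ?_
  rw [inner_transitionOp_right_eq_integral, Submodule.coe_inner, real_inner_L2]
  refine (integral_mul_compProd_comap hP (.id π) (Lp.memLp (g : Lp ℝ 2 π)) hf).trans
    (integral_congr_ae ?_)
  filter_upwards [coeFn_center hPf] with x hx
  rw [hx, hmean, sub_zero, id_eq]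

theorem isSelfAdjoint_transitionOp (hrev : P.IsReversible π) (hP : P.Invariant π) :
    IsSelfAdjoint (transitionOp hP) := by
  rw [ContinuousLinearMap.isSelfAdjoint_iff_isSymmetric]
  intro f g
  have hsm (h : meanZeroL2 π) := (Lp.stronglyMeasurable (h : Lp ℝ 2 π)).measurable
  rw [ContinuousLinearMap.coe_coe, real_inner_comm, inner_transitionOp_right_eq_integral,
    inner_transitionOp_right_eq_integral,
    ← (isReversible_iff_measurePreserving_swap.1 hrev).hasLaw.integral_comp]
  · simp only [Function.comp_def, Prod.fst_swap, Prod.snd_swap, mul_comm]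
  · exact (((hsm g).comp measurable_fst).mul
      ((hsm f).comp measurable_snd)).aestronglyMeasurable

theorem norm_embedFst_sub_embedSnd_sq (hP : P.Invariant π) (f : meanZeroL2 π) :
    ‖embedFst π P f - embedSnd hP f‖ ^ 2 = 2 * (‖f‖ ^ 2 - ⟪f, transitionOp hP f⟫) := by
  rw [norm_sub_sq_real, LinearIsometry.norm_map, LinearIsometry.norm_map, inner_transitionOp_right]
  ring

end TransitionOperator

section Chain

variable {α : Type*} [MeasurableSpace α] {π : Measure α} {P : Kernel α α}

local notation "⟪" x ", " y "⟫" => inner ℝ x y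

theorem measurable_snoc (n : ℕ) :
    Measurable (fun p : (Fin (n + 1) → α) × α => (Fin.snoc p.1 p.2 : Fin (n + 2) → α)) := by
  refine measurable_pi_iff.2 (Fin.lastCases ?_ fun j => ?_)
  · simpa only [Fin.snoc_last] using measurable_snd
  · simpa only [Fin.snoc_castSucc] using! (measurable_pi_apply j).comp measurable_fst

theorem measurePreserving_snoc (n : ℕ) :
    MeasurePreserving (fun p : (Fin (n + 1) → α) × α => (Fin.snoc p.1 p.2 : Fin (n + 2) → α))
      (chainLaw P π n ⊗ₘ P.comap (fun ω => ω (Fin.last n)) (measurable_pi_apply _))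
      (chainLaw P π (n + 1)) :=
  ⟨measurable_snoc n, rfl⟩

variable [IsProbabilityMeasure π] [IsMarkovKernel P]

instance (n : ℕ) : IsProbabilityMeasure (chainLaw P π n) := by
  induction n with
  | zero => exact Measure.isProbabilityMeasure_map (by fun_prop)
  | succ n ih => exact Measure.isProbabilityMeasure_map (measurable_snoc n).aemeasurable

theorem measurePreserving_init (n : ℕ) :
    MeasurePreserving (fun (ω : Fin (n + 2) → α) (i : Fin (n + 1)) => ω i.castSucc)
      (chainLaw P π (n + 1)) (chainLaw P π n) := by
  refine ⟨by fun_prop, ?_⟩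
  rw [← (measurePreserving_snoc n).map_eq, Measure.map_map (by fun_prop) (measurable_snoc n)]
  simpa only [Function.comp_def, Fin.snoc_castSucc] using
    (measurePreserving_fst_compProd (μ := chainLaw P π n)
      (P.comap (fun ω : Fin (n + 1) → α => ω (Fin.last n)) (measurable_pi_apply _))).map_eq

theorem measurePreserving_eval_chainLaw (hP : P.Invariant π) {n : ℕ} (i : Fin (n + 1)) :
    MeasurePreserving (fun ω => ω i) (chainLaw P π n) π := by
  induction n with
  | zero =>
    refine ⟨measurable_pi_apply i, ?_⟩
    rw [chainLaw, Measure.map_map (measurable_pi_apply i) (by fun_prop)]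
    exact Measure.map_id
  | succ n ih =>
    cases i using Fin.lastCases with
    | cast i => exact (ih i).comp (measurePreserving_init n)
    | last =>
      refine ⟨measurable_pi_apply _, ?_⟩
      rw [← (measurePreserving_snoc n).map_eq,
        Measure.map_map (measurable_pi_apply _) (measurable_snoc n)]
      simpa only [Function.comp_def, Fin.snoc_last] using
        (measurePreserving_snd_compProd_comap hP (ih (Fin.last n))).map_eq

theorem integral_mul_eval_last_chainLaw (hP : P.Invariant π) {n : ℕ} {G : (Fin (n + 1) → α) → ℝ}
    (hG : Measurable G) (hG2 : MemLp G 2 (chainLaw P π n)) (f : meanZeroL2 π) :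
    ∫ ω, G (fun i => ω i.castSucc) * (f : Lp ℝ 2 π) (ω (Fin.last (n + 1)))
        ∂chainLaw P π (n + 1) =
      ∫ ω, G ω * (transitionOp hP f : Lp ℝ 2 π) (ω (Fin.last n)) ∂chainLaw P π n := by
  have hlast := measurePreserving_eval_chainLaw (P := P) hP (Fin.last n)
  have hf := (Lp.stronglyMeasurable (f : Lp ℝ 2 π)).measurable
  rw [← (measurePreserving_snoc n).hasLaw.integral_comp (by fun_prop)]
  simp only [Function.comp_def, Fin.snoc_castSucc, Fin.snoc_last]
  refine (integral_mul_compProd_comap hP hlast hG2 (Lp.memLp _)).trans (integral_congr_ae ?_)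
  filter_upwards [hlast.quasiMeasurePreserving.ae (coeFn_transitionOp hP f)] with ω hω
  rw [hω]

theorem integral_eval_mul_eval_chainLaw (hP : P.Invariant π) (f g : meanZeroL2 π) {n : ℕ}
    {i j : Fin (n + 1)} (hij : i ≤ j) :
    ∫ ω, (f : Lp ℝ 2 π) (ω i) * (g : Lp ℝ 2 π) (ω j) ∂chainLaw P π n =
      ⟪f, (transitionOp hP ^ (j - i : ℕ)) g⟫ := by
  have hsm (h : meanZeroL2 π) := (Lp.stronglyMeasurable (h : Lp ℝ 2 π)).measurable
  have hdiag {n : ℕ} (i : Fin (n + 1)) (g : meanZeroL2 π) :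
      ∫ ω, (f : Lp ℝ 2 π) (ω i) * (g : Lp ℝ 2 π) (ω i) ∂chainLaw P π n = ⟪f, g⟫ := by
    rw [Submodule.coe_inner, real_inner_L2]
    exact (measurePreserving_eval_chainLaw hP i).hasLaw.integral_comp
      ((hsm f).mul (hsm g)).aestronglyMeasurable
  induction n generalizing g with
  | zero => simpa [Fin.fin_one_eq_zero] using hdiag 0 g
  | succ n ih =>
    cases j using Fin.lastCases with
    | cast j =>
      obtain ⟨i, rfl⟩ := Fin.exists_castSucc_eq.2 (hij.trans_lt (Fin.castSucc_lt_last j)).ne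
      rw [Fin.val_castSucc, Fin.val_castSucc, ← ih g (Fin.castSucc_le_castSucc_iff.1 hij)]
      exact (measurePreserving_init (π := π) (P := P) n).hasLaw.integral_comp
        (((hsm f).comp (measurable_pi_apply i)).mul
          ((hsm g).comp (measurable_pi_apply j))).aestronglyMeasurable
    | last =>
      cases i using Fin.lastCases with
      | last => simpa using hdiag (Fin.last _) g
      | cast i =>
        have hfi : MemLp (fun ω => (f : Lp ℝ 2 π) (ω i)) 2 (chainLaw P π n) :=
          (Lp.memLp _).comp_measurePreserving (measurePreserving_eval_chainLaw hP i)
        refine (integral_mul_eval_last_chainLaw hP ((hsm f).comp (measurable_pi_apply i))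
          hfi g).trans ?_
        rw [Function.comp_def, ih _ (Fin.le_last i), ← mul_apply_eq_comp, ← pow_succ,
          Fin.val_last, Fin.val_last, Fin.val_castSucc,
          ← Nat.sub_add_comm (Nat.lt_succ_iff.1 i.isLt)]

theorem covariance_eval_chainLaw (hP : P.Invariant π) {f : α → ℝ} (hf : MemLp f 2 π) {n : ℕ}
    {i j : Fin (n + 1)} (hij : i ≤ j) :
    cov[fun ω => f (ω i), fun ω => f (ω j); chainLaw P π n] =
      ⟪center hf, (transitionOp hP ^ (j - i : ℕ)) (center hf)⟫ := by
  have hpres (k : Fin (n + 1)) : MeasurePreserving (fun ω => ω k) (chainLaw P π n) π :=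
    measurePreserving_eval_chainLaw hP k
  have hmean (k : Fin (n + 1)) : ∫ ω, f (ω k) ∂chainLaw P π n = ∫ x, f x ∂π :=
    (hpres k).hasLaw.integral_comp hf.1
  rw [← integral_eval_mul_eval_chainLaw hP _ _ hij, covariance, hmean, hmean]
  refine integral_congr_ae ?_
  filter_upwards [(hpres i).quasiMeasurePreserving.ae (coeFn_center hf),
    (hpres j).quasiMeasurePreserving.ae (coeFn_center hf)] with ω hi hj
  rw [hi, hj]

theorem scaledVariance_eq_inner_pathSum (hP : P.Invariant π) {f : α → ℝ} (hf : MemLp f 2 π)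
    (n : ℕ) : scaledVariance f P π n =
      ⟪center hf, pathSum (transitionOp hP) (n + 1) (center hf)⟫ / (n + 1 : ℕ) := by
  have hmem (i : Fin (n + 1)) : MemLp (fun ω => f (ω i)) 2 (chainLaw P π n) :=
    hf.comp_measurePreserving (measurePreserving_eval_chainLaw hP i)
  have hcov (i j : Fin (n + 1)) : cov[fun ω => f (ω i), fun ω => f (ω j); chainLaw P π n] =
      ⟪center hf, (transitionOp hP ^ Nat.dist i j) (center hf)⟫ := by
    rcases le_total i j with hij | hij
    · rw [covariance_eval_chainLaw hP hf hij, Nat.dist_eq_sub_of_le hij]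
    · rw [covariance_comm, covariance_eval_chainLaw hP hf hij, Nat.dist_eq_sub_of_le_right hij]
  rw [scaledVariance, variance_const_mul, variance_fun_sum hmem, pathSum]
  simp only [hcov, sum_apply, inner_sum, Finset.sum_range, Nat.cast_succ]
  field_simp

theorem varianceBounding_iff_hasSpectralGap (hrev : P.IsReversible π) (hP : P.Invariant π) :
    VarianceBounding P π ↔ HasSpectralGap (transitionOp hP) := by
  have hT := isSelfAdjoint_transitionOp hrev hP
  have hT1 := norm_transitionOp_le_one hP
  refine ⟨fun hVB => hasSpectralGap_of_abs_inner_pathSum_le hT hT1 fun f => ?_,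
    fun hgap f hf => ?_⟩
  · obtain ⟨v, hv⟩ := hVB _ (Lp.memLp (f : Lp ℝ 2 π))
    replace hv := hv.congr (scaledVariance_eq_inner_pathSum hP (Lp.memLp (f : Lp ℝ 2 π)))
    rw [center_coe] at hv
    obtain ⟨C, hC⟩ := ((tendsto_add_atTop_iff_nat
      (f := fun N : ℕ => ⟪f, pathSum (transitionOp hP) N f⟫ / N) 1).1 hv).abs.bddAbove_range
    exact ⟨C, fun N => hC ⟨N, rfl⟩⟩
  · obtain ⟨v, hv⟩ := hgap.exists_tendsto hT hT1 (center hf)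
    exact ⟨v, ((tendsto_add_atTop_iff_nat 1).2 hv).congr fun n =>
      (scaledVariance_eq_inner_pathSum hP hf n).symm⟩

end Chain

/-! ### Poincaré inequalities -/

section Poincare

variable {α : Type*} [MeasurableSpace α] {π : Measure α}

/-- The Poincaré inequality: the variance under `π` is at most a constant times the Dirichlet form
`f ↦ ∫ (f(x) - f(y))² J(dx, dy)` of the flow `J`. The values are extended nonnegative reals, so that
nothing has to be integrable. -/
def PoincareInequality (π : Measure α) (J : Measure (α × α)) : Prop :=
  ∃ c : ℝ≥0, 0 < c ∧ ∀ f : α → ℝ, Measurable f → MemLp f 2 π →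
    c * eVar[f; π] ≤ ∫⁻ z, ‖f z.1 - f z.2‖ₑ ^ 2 ∂J

theorem enorm_sq_eq_lintegral {μ : Measure α} (F : Lp ℝ 2 μ) :
    ‖F‖ₑ ^ 2 = ∫⁻ x, ‖F x‖ₑ ^ 2 ∂μ := by
  rw [Lp.enorm_def]
  simpa using eLpNorm_nnreal_pow_eq_lintegral (f := F) (μ := μ) (p := 2) two_ne_zero

section SpectralGap

variable [IsProbabilityMeasure π] {P : Kernel α α} [IsMarkovKernel P]

theorem enorm_center_sq {f : α → ℝ} (hf : MemLp f 2 π) : ‖center hf‖ₑ ^ 2 = eVar[f; π] := by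
  refine (enorm_sq_eq_lintegral (center hf : Lp ℝ 2 π)).trans (lintegral_congr_ae ?_)
  filter_upwards [coeFn_center hf] with x hx
  rw [hx]

theorem enorm_embedFst_sub_embedSnd_center_sq (hP : P.Invariant π) {f : α → ℝ}
    (hf : MemLp f 2 π) :
    ‖embedFst π P (center hf) - embedSnd hP (center hf)‖ₑ ^ 2 =
      ∫⁻ z, ‖f z.1 - f z.2‖ₑ ^ 2 ∂(π ⊗ₘ P) := by
  rw [enorm_sq_eq_lintegral]
  refine lintegral_congr_ae ?_
  filter_upwards [Lp.coeFn_sub (embedFst π P (center hf)) (embedSnd hP (center hf)),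
    coeFn_embedFst (P := P) (center hf), coeFn_embedSnd hP (center hf),
    (measurePreserving_fst_compProd P).quasiMeasurePreserving.ae (coeFn_center hf),
    (measurePreserving_snd_compProd hP).quasiMeasurePreserving.ae (coeFn_center hf)]
    with z hsub hfst hsnd h₁ h₂
  rw [hsub, Pi.sub_apply, hfst, hsnd, h₁, h₂, sub_sub_sub_cancel_right]

theorem hasSpectralGap_transitionOp_iff (hP : P.Invariant π) :
    HasSpectralGap (transitionOp hP) ↔ ∃ c : ℝ≥0, 0 < c ∧ ∀ u : meanZeroL2 π,
      c * ‖u‖ₑ ^ 2 ≤ ‖embedFst π P u - embedSnd hP u‖ₑ ^ 2 := by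
  have hreal (c : ℝ≥0) (u : meanZeroL2 π) :
      (c : ℝ≥0∞) * ‖u‖ₑ ^ 2 ≤ ‖embedFst π P u - embedSnd hP u‖ₑ ^ 2 ↔
        (c : ℝ) / 2 * ‖u‖ ^ 2 ≤ ‖u‖ ^ 2 - inner ℝ u (transitionOp hP u) := by
    rw [div_mul_eq_mul_div, div_le_iff₀' two_pos, ← norm_embedFst_sub_embedSnd_sq]
    simp only [enorm_eq_nnnorm]
    norm_cast
  constructor
  · rintro ⟨c, hc, hgap⟩
    refine ⟨(2 * c).toNNReal, by simpa using hc, fun u => (hreal _ u).2 ?_⟩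
    rw [Real.coe_toNNReal _ (by positivity), mul_div_cancel_left₀ _ two_ne_zero]
    exact hgap u
  · rintro ⟨c, hc, hgap⟩
    exact ⟨c / 2, by positivity, fun u => (hreal c u).1 (hgap u)⟩

theorem varianceBounding_iff_poincareInequality (hrev : P.IsReversible π) :
    VarianceBounding P π ↔ PoincareInequality π (π ⊗ₘ P) := by
  have hP := hrev.invariant
  rw [varianceBounding_iff_hasSpectralGap hrev hP, hasSpectralGap_transitionOp_iff]
  refine exists_congr fun c => and_congr_right fun _ => ⟨fun hgap f _ hf => ?_, fun hgap u => ?_⟩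
  · rw [← enorm_center_sq hf, ← enorm_embedFst_sub_embedSnd_center_sq hP hf]
    exact hgap (center hf)
  · have hu := hgap u (Lp.stronglyMeasurable _).measurable (Lp.memLp (u : Lp ℝ 2 π))
    rwa [← enorm_center_sq (Lp.memLp _), ← enorm_embedFst_sub_embedSnd_center_sq hP (Lp.memLp _),
      center_coe] at hu

end SpectralGap

theorem enorm_sub_sq_le (a b : ℝ) : ‖a - b‖ₑ ^ 2 ≤ 2 * (‖a‖ₑ ^ 2 + ‖b‖ₑ ^ 2) := by
  simp only [enorm_eq_nnnorm]
  norm_cast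
  exact (pow_le_pow_left₀ zero_le (nnnorm_sub_le a b) 2).trans add_sq_le

theorem lintegral_enorm_sub_sq_le {J : Measure (α × α)} (hJ : MeasurePreserving Prod.swap J J)
    {g : α → ℝ} (hg : Measurable g) :
    ∫⁻ z, ‖g z.1 - g z.2‖ₑ ^ 2 ∂J ≤ 4 * ∫⁻ x, ‖g x‖ₑ ^ 2 ∂J.fst := by
  have hfst : ∫⁻ z, ‖g z.1‖ₑ ^ 2 ∂J = ∫⁻ x, ‖g x‖ₑ ^ 2 ∂J.fst :=
    (lintegral_map (f := fun x => ‖g x‖ₑ ^ 2) (by fun_prop) measurable_fst).symm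
  have hsnd : ∫⁻ z, ‖g z.2‖ₑ ^ 2 ∂J = ∫⁻ z, ‖g z.1‖ₑ ^ 2 ∂J :=
    hJ.lintegral_comp (f := fun z => ‖g z.1‖ₑ ^ 2) (by fun_prop)
  calc ∫⁻ z, ‖g z.1 - g z.2‖ₑ ^ 2 ∂J ≤ ∫⁻ z, 2 * (‖g z.1‖ₑ ^ 2 + ‖g z.2‖ₑ ^ 2) ∂J :=
        lintegral_mono fun z => enorm_sub_sq_le _ _
    _ = 4 * ∫⁻ x, ‖g x‖ₑ ^ 2 ∂J.fst := by
        rw [lintegral_const_mul _ (by fun_prop), lintegral_add_left (by fun_prop), hsnd, hfst]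
        ring

/-- The flow `J` is dominated by a multiple of `K` outside a set of moves that has arbitrarily small
`J`-probability from every state. That set, `Dᶜ`, is required to be closed under reversal. -/
def DominatedUpToRareMoves (π : Measure α) (J K : Measure (α × α)) : Prop :=
  ∀ ε : ℝ≥0, 0 < ε → ∃ D : Set (α × α), MeasurableSet D ∧ Prod.swap ⁻¹' D = D ∧
    (J.restrict Dᶜ).fst ≤ ε • π ∧ ∃ L : ℝ≥0, J.restrict D ≤ L • K

theorem lintegral_enorm_sub_sq_restrict_compl_le [IsFiniteMeasure π] {J : Measure (α × α)}
    (hJ : MeasurePreserving Prod.swap J J) {D : Set (α × α)} (hD : MeasurableSet D)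
    (hDswap : Prod.swap ⁻¹' D = D) {ε : ℝ≥0} (hε : (J.restrict Dᶜ).fst ≤ ε • π) {f : α → ℝ}
    (hf : Measurable f) :
    ∫⁻ z in Dᶜ, ‖f z.1 - f z.2‖ₑ ^ 2 ∂J ≤ 4 * (ε * eVar[f; π]) := by
  have hJD : MeasurePreserving Prod.swap (J.restrict Dᶜ) (J.restrict Dᶜ) := by
    simpa only [Set.preimage_compl, hDswap] using hJ.restrict_preimage hD.compl
  have hfar := lintegral_enorm_sub_sq_le hJD (hf.sub_const (∫ x, f x ∂π))
  simp only [sub_sub_sub_cancel_right] at hfar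
  refine hfar.trans (mul_le_mul_right ((lintegral_mono' hε le_rfl).trans_eq ?_) 4)
  exact lintegral_smul_measure ..

theorem PoincareInequality.of_dominatedUpToRareMoves [IsFiniteMeasure π] {J K : Measure (α × α)}
    (hJ : MeasurePreserving Prod.swap J J) (hJK : DominatedUpToRareMoves π J K)
    (h : PoincareInequality π J) : PoincareInequality π K := by
  obtain ⟨c, hc, hgap⟩ := h
  obtain ⟨D, hD, hDswap, hε, L, hL⟩ := hJK (c / 8) (by positivity)
  refine ⟨c / 2 / (L + 1), by positivity, fun f hf hf2 => ?_⟩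
  have hnear : ∫⁻ z in D, ‖f z.1 - f z.2‖ₑ ^ 2 ∂J ≤ L * ∫⁻ z, ‖f z.1 - f z.2‖ₑ ^ 2 ∂K :=
    (lintegral_mono' hL le_rfl).trans_eq (lintegral_smul_measure ..)
  have hfar := lintegral_enorm_sub_sq_restrict_compl_le hJ hD hDswap hε hf
  have hsum := ((hgap f hf hf2).trans_eq (lintegral_add_compl _ hD).symm).trans
    (add_le_add hnear hfar)
  have hV : eVar[f; π] ≠ ∞ := hf2.evariance_ne_top
  generalize eVar[f; π] = V, ∫⁻ z, ‖f z.1 - f z.2‖ₑ ^ 2 ∂K = E at hsum hV ⊢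
  rcases eq_or_ne E ∞ with rfl | hE
  · exact le_top
  lift V to ℝ≥0 using hV
  lift E to ℝ≥0 using hE
  norm_cast at hsum ⊢
  rw [div_mul_eq_mul_div, div_le_iff₀ (by positivity), ← NNReal.coe_le_coe]
  rw [← NNReal.coe_le_coe] at hsum
  push_cast at hsum ⊢
  linarith [E.coe_nonneg]

end Poincare

/-! ### Propose-accept-reject kernels -/

section ParKernel

variable {α : Type*} [MeasurableSpace α] {vol : Measure α} [SFinite vol] {p : α → ℝ≥0}
  {q : α → α → ℝ≥0} {a b : α → α → ℝ≥0∞}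

theorem lintegral_parKernel (hq : Measurable (Function.uncurry q))
    (ha : Measurable (Function.uncurry a)) {F : α → ℝ≥0∞} (hF : Measurable F) (x : α) :
    ∫⁻ y, F y ∂(parKernel vol q a x) = ∫⁻ y, q x y * a x y * F y ∂vol +
      (1 - ∫⁻ z, (q x z : ℝ≥0∞) * a x z ∂vol) * F x := by
  have hqa : Measurable (Function.uncurry fun x y => (q x y : ℝ≥0∞) * a x y) :=
    hq.coe_nnreal_ennreal.mul ha
  have hrej : Measurable (Function.uncurry fun (x _ : α) =>
      1 - ∫⁻ z, (q x z : ℝ≥0∞) * a x z ∂vol) :=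
    (measurable_const.sub hqa.lintegral_prod_right').comp measurable_fst
  rw [parKernel, FunLike.coe_add, Pi.add_apply, lintegral_add_measure,
    Kernel.lintegral_withDensity _ hqa _ hF, Kernel.lintegral_withDensity _ hrej _ hF]
  simp only [Kernel.const_apply, Kernel.id_apply]
  rw [lintegral_dirac' x (hF.const_mul _)]

theorem isMarkovKernel_parKernel (hq : Measurable (Function.uncurry q))
    (hq_one : ∀ x, ∫⁻ y, (q x y : ℝ≥0∞) ∂vol = 1) (ha : Measurable (Function.uncurry a))
    (ha_le : ∀ x y, a x y ≤ 1) : IsMarkovKernel (parKernel vol q a) := by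
  refine ⟨fun x => ⟨?_⟩⟩
  have hacc : ∫⁻ y, (q x y : ℝ≥0∞) * a x y ∂vol ≤ 1 :=
    (lintegral_mono fun y => mul_le_of_le_one_right' (ha_le x y)).trans (hq_one x).le
  rw [← lintegral_one, lintegral_parKernel hq ha measurable_const]
  simpa only [mul_one] using add_tsub_cancel_of_le hacc

/-- The density `p(x) q(x, y) a(x, y)` of the accepted moves from `x` to `y` in stationarity. -/
noncomputable def flowDensity (p : α → ℝ≥0) (q : α → α → ℝ≥0) (a : α → α → ℝ≥0∞)
    (z : α × α) : ℝ≥0∞ :=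
  p z.1 * q z.1 z.2 * a z.1 z.2

theorem measurable_flowDensity (hp : Measurable p) (hq : Measurable (Function.uncurry q))
    (ha : Measurable (Function.uncurry a)) : Measurable (flowDensity p q a) :=
  ((hp.comp measurable_fst).coe_nnreal_ennreal.mul hq.coe_nnreal_ennreal).mul ha

/-- The joint law of two successive states of the stationary chain, restricted to accepted moves. -/
noncomputable def acceptedFlow (vol : Measure α) (p : α → ℝ≥0) (q : α → α → ℝ≥0)
    (a : α → α → ℝ≥0∞) : Measure (α × α) :=
  (vol.prod vol).withDensity (flowDensity p q a)

theorem lintegral_compProd_parKernel [IsSFiniteKernel (parKernel vol q a)] (hp : Measurable p)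
    (hq : Measurable (Function.uncurry q)) (ha : Measurable (Function.uncurry a))
    {G : α × α → ℝ≥0∞} (hG : Measurable G) :
    ∫⁻ z, G z ∂(vol.withDensity (fun x => (p x : ℝ≥0∞)) ⊗ₘ parKernel vol q a) =
      ∫⁻ z, G z ∂(acceptedFlow vol p q a) +
        ∫⁻ x, (1 - ∫⁻ y, (q x y : ℝ≥0∞) * a x y ∂vol) * G (x, x)
          ∂(vol.withDensity fun x => (p x : ℝ≥0∞)) := by
  have hqaG : Measurable fun z : α × α => (q z.1 z.2 : ℝ≥0∞) * a z.1 z.2 * G z :=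
    (hq.coe_nnreal_ennreal.mul ha).mul hG
  have hflow : ∫⁻ z, G z ∂(acceptedFlow vol p q a) =
      ∫⁻ x, ∫⁻ y, q x y * a x y * G (x, y) ∂vol ∂(vol.withDensity fun x => (p x : ℝ≥0∞)) := by
    have hdens := measurable_flowDensity hp hq ha
    rw [acceptedFlow, lintegral_withDensity_eq_lintegral_mul _ hdens hG,
      lintegral_prod _ (hdens.mul hG).aemeasurable,
      lintegral_withDensity_eq_lintegral_mul _ hp.coe_nnreal_ennreal hqaG.lintegral_prod_right']
    refine lintegral_congr fun x => ?_
    have hsection : Measurable fun y => q x y * a x y * G (x, y) :=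
      hqaG.comp measurable_prodMk_left
    rw [Pi.mul_apply, ← lintegral_const_mul _ hsection]
    simp only [Pi.mul_apply, flowDensity, mul_assoc]
  rw [hflow, Measure.lintegral_compProd hG, ← lintegral_add_left hqaG.lintegral_prod_right']
  exact lintegral_congr fun x => lintegral_parKernel hq ha (hG.comp measurable_prodMk_left) x

theorem poincareInequality_compProd_parKernel_iff [IsSFiniteKernel (parKernel vol q a)]
    (hp : Measurable p) (hq : Measurable (Function.uncurry q))
    (ha : Measurable (Function.uncurry a)) {π : Measure α} :
    PoincareInequality π (vol.withDensity (fun x => (p x : ℝ≥0∞)) ⊗ₘ parKernel vol q a) ↔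
      PoincareInequality π (acceptedFlow vol p q a) := by
  refine exists_congr fun c => and_congr_right fun _ => forall₂_congr fun f hf => ?_
  rw [lintegral_compProd_parKernel hp hq ha (by fun_prop)]
  simp

theorem fst_restrict_compl_acceptedFlow_le (hp : Measurable p)
    (hq : Measurable (Function.uncurry q)) (ha : Measurable (Function.uncurry a))
    (ha_le : ∀ x y, a x y ≤ 1) {D : Set (α × α)} (hD : MeasurableSet D) {ε : ℝ≥0}
    (hε : ∀ x, ∫⁻ y in {y | (x, y) ∈ D}ᶜ, (q x y : ℝ≥0∞) ∂vol ≤ ε) :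
    ((acceptedFlow vol p q a).restrict Dᶜ).fst ≤ ε • vol.withDensity fun x => (p x : ℝ≥0∞) := by
  have hdens := measurable_flowDensity hp hq ha
  refine Measure.le_iff.2 fun s hs => ?_
  have hsD : MeasurableSet (Prod.fst ⁻¹' s ∩ Dᶜ) := (measurable_fst hs).inter hD.compl
  rw [Measure.fst_apply hs, Measure.restrict_apply (measurable_fst hs), acceptedFlow,
    withDensity_apply _ hsD, ← lintegral_indicator hsD,
    lintegral_prod _ (hdens.indicator hsD).aemeasurable, Measure.smul_apply,
    withDensity_apply _ hs, ← lintegral_indicator hs, ENNReal.smul_def, smul_eq_mul,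
    ← lintegral_const_mul _ (hp.coe_nnreal_ennreal.indicator hs)]
  refine lintegral_mono fun x => ?_
  by_cases hx : x ∈ s
  · have hDx : MeasurableSet {y | (x, y) ∈ D}ᶜ := (measurable_prodMk_left hD).compl
    have hqx : Measurable fun y => (q x y : ℝ≥0∞) :=
      hq.coe_nnreal_ennreal.comp measurable_prodMk_left
    calc ∫⁻ y, (Prod.fst ⁻¹' s ∩ Dᶜ).indicator (flowDensity p q a) (x, y) ∂vol
        = ∫⁻ y in {y | (x, y) ∈ D}ᶜ, flowDensity p q a (x, y) ∂vol := by
          rw [← lintegral_indicator hDx]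
          refine lintegral_congr fun y => ?_
          by_cases hy : (x, y) ∈ D <;> simp [hx, hy]
      _ ≤ ∫⁻ y in {y | (x, y) ∈ D}ᶜ, (p x : ℝ≥0∞) * q x y ∂vol :=
          lintegral_mono fun y => mul_le_of_le_one_right' (ha_le x y)
      _ = (p x : ℝ≥0∞) * ∫⁻ y in {y | (x, y) ∈ D}ᶜ, (q x y : ℝ≥0∞) ∂vol :=
          lintegral_const_mul _ hqx
      _ ≤ ε * s.indicator (fun x => (p x : ℝ≥0∞)) x := by
          rw [Set.indicator_of_mem hx, mul_comm]
          exact mul_le_mul_left (hε x) _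
  · simp [hx]

omit [SFinite vol] in
theorem restrict_acceptedFlow_le (hp : Measurable p) (hq : Measurable (Function.uncurry q))
    (hb : Measurable (Function.uncurry b)) {D : Set (α × α)} (hD : MeasurableSet D) {L : ℝ≥0}
    (hL : ∀ᵐ z ∂(vol.prod vol), z ∈ D → flowDensity p q a z ≤ L * flowDensity p q b z) :
    (acceptedFlow vol p q a).restrict D ≤ L • acceptedFlow vol p q b := by
  calc (acceptedFlow vol p q a).restrict D
      = ((vol.prod vol).restrict D).withDensity (flowDensity p q a) := restrict_withDensity hD _
    _ ≤ ((vol.prod vol).restrict D).withDensity ((L : ℝ≥0∞) • flowDensity p q b) :=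
        withDensity_mono ((ae_restrict_iff' hD).2 hL)
    _ = L • (acceptedFlow vol p q b).restrict D := by
        rw [withDensity_smul _ (measurable_flowDensity hp hq hb), acceptedFlow,
          restrict_withDensity hD, ENNReal.smul_def]
    _ ≤ L • acceptedFlow vol p q b := by
        gcongr
        exact Measure.restrict_le_self

/-- The acceptance probability `a` is in detailed balance with the target density `p` and the
proposal density `q`, that is, the accepted moves are symmetric under reversal. -/
structure IsBalancedAcceptance (vol : Measure α) (p : α → ℝ≥0) (q : α → α → ℝ≥0)
    (a : α → α → ℝ≥0∞) : Prop where
  measurable : Measurable (Function.uncurry a)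
  le_one : ∀ x y, a x y ≤ 1
  flowDensity_swap : ∀ᵐ z ∂(vol.prod vol), flowDensity p q a z.swap = flowDensity p q a z

namespace IsBalancedAcceptance

theorem measurePreserving_swap_acceptedFlow (ha : IsBalancedAcceptance vol p q a)
    (hp : Measurable p) (hq : Measurable (Function.uncurry q)) :
    MeasurePreserving Prod.swap (acceptedFlow vol p q a) (acceptedFlow vol p q a) := by
  have hdens := measurable_flowDensity hp hq ha.measurable
  refine ⟨measurable_swap, Measure.ext_of_lintegral _ fun G hG => ?_⟩
  have hGswap : Measurable fun z : α × α => G z.swap := hG.comp measurable_swap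
  rw [lintegral_map hG measurable_swap, acceptedFlow,
    lintegral_withDensity_eq_lintegral_mul _ hdens hGswap,
    lintegral_withDensity_eq_lintegral_mul _ hdens hG, ← lintegral_prod_swap]
  refine lintegral_congr_ae ?_
  filter_upwards [ha.flowDensity_swap] with z hz
  simp only [Pi.mul_apply, hz, Prod.swap_swap]

theorem isReversible_parKernel (ha : IsBalancedAcceptance vol p q a)
    [IsFiniteMeasure (vol.withDensity fun x => (p x : ℝ≥0∞))] [IsMarkovKernel (parKernel vol q a)]
    (hp : Measurable p) (hq : Measurable (Function.uncurry q)) :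
    (parKernel vol q a).IsReversible (vol.withDensity fun x => (p x : ℝ≥0∞)) := by
  refine isReversible_iff_measurePreserving_swap.2
    ⟨measurable_swap, Measure.ext_of_lintegral _ fun G hG => ?_⟩
  rw [lintegral_map hG measurable_swap,
    lintegral_compProd_parKernel (G := fun z => G z.swap) hp hq ha.measurable
      (hG.comp measurable_swap),
    lintegral_compProd_parKernel hp hq ha.measurable hG,
    (ha.measurePreserving_swap_acceptedFlow hp hq).lintegral_comp hG]
  rfl

theorem varianceBounding_parKernel_iff (ha : IsBalancedAcceptance vol p q a)
    (hp : Measurable p) (hp_one : ∫⁻ x, (p x : ℝ≥0∞) ∂vol = 1)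
    (hq : Measurable (Function.uncurry q)) (hq_one : ∀ x, ∫⁻ y, (q x y : ℝ≥0∞) ∂vol = 1) :
    VarianceBounding (parKernel vol q a) (vol.withDensity fun x => (p x : ℝ≥0∞)) ↔
      PoincareInequality (vol.withDensity fun x => (p x : ℝ≥0∞)) (acceptedFlow vol p q a) := by
  have : IsProbabilityMeasure (vol.withDensity fun x => (p x : ℝ≥0∞)) :=
    ⟨by rw [withDensity_apply _ .univ, setLIntegral_univ, hp_one]⟩
  have := isMarkovKernel_parKernel hq hq_one ha.measurable ha.le_one
  rw [varianceBounding_iff_poincareInequality (ha.isReversible_parKernel hp hq),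
    poincareInequality_compProd_parKernel_iff hp hq ha.measurable]

end IsBalancedAcceptance

end ParKernel

/-! ### Delayed acceptance against Metropolis–Hastings -/

section MinOne

variable {M : Type*} [CommMonoid M] [LinearOrder M] [IsOrderedMonoid M] {r s L : M}

theorem min_one_mul_le_mul_min_one (hL : 1 ≤ L) (hLs : 1 ≤ L * s) (hsL : s ≤ L) :
    min 1 (r * s) ≤ L * (min 1 r * min 1 s) := by
  rcases le_total 1 r with hr | hr <;> rcases le_total 1 s with hs | hs <;>
    simp only [min_eq_left, min_eq_right, hr, hs, one_mul, mul_one]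
  · exact min_le_of_left_le hL
  · exact min_le_of_left_le hLs
  · exact min_le_of_right_le (mul_comm L r ▸ mul_le_mul_right hsL r)
  · exact min_le_of_right_le (le_mul_of_one_le_left' hL)

theorem min_one_mul_min_one (h : (r ≤ 1 ∧ s ≤ 1) ∨ (1 ≤ r ∧ 1 ≤ s)) :
    min 1 r * min 1 s = min 1 (r * s) := by
  rcases h with ⟨hr, hs⟩ | ⟨hr, hs⟩
  · rw [min_eq_right hr, min_eq_right hs, min_eq_right (mul_le_one' hr hs)]
  · rw [min_eq_left hr, min_eq_left hs, min_eq_left (one_le_mul hr hs), one_mul]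

end MinOne

theorem nonpos_or_nonneg_of_sign_mul_sign_nonneg {α : Type*} [Zero α] [LinearOrder α] {x y : α}
    (h : 0 ≤ SignType.sign x * SignType.sign y) : (x ≤ 0 ∧ y ≤ 0) ∨ (0 ≤ x ∧ 0 ≤ y) := by
  rcases lt_trichotomy x 0 with hx | rfl | hx <;> rcases lt_trichotomy y 0 with hy | rfl | hy <;>
    simp_all [le_of_lt]

theorem mul_min_one_div {A : ℝ≥0∞} (hA : A ≠ ∞) (B : ℝ≥0∞) : A * min 1 (B / A) = min A B := by
  rcases eq_or_ne A 0 with rfl | h0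
  · simp
  · rw [mul_min, mul_one, ENNReal.mul_div_cancel h0 hA]

theorem bounds_of_abs_log_le {s : ℝ≥0∞} {M : ℝ≥0} (h : (ENNReal.log s).abs ≤ M) :
    1 ≤ ENNReal.ofReal (Real.exp M) * s ∧ s ≤ ENNReal.ofReal (Real.exp M) := by
  have hs : s ≠ ∞ := by
    rintro rfl
    simp at h
  obtain ⟨t, ht0, rfl⟩ : ∃ t, 0 ≤ t ∧ s = ENNReal.ofReal t :=
    ⟨s.toReal, ENNReal.toReal_nonneg, (ENNReal.ofReal_toReal hs).symm⟩
  have ht : 0 < t := ht0.lt_of_ne' fun h0 => by simp [h0] at h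
  rw [ENNReal.log_ofReal_of_pos ht, EReal.abs_def, ← ENNReal.ofReal_coe_nnreal,
    ENNReal.ofReal_le_ofReal_iff M.coe_nonneg, abs_le, Real.le_log_iff_exp_le ht,
    Real.log_le_iff_le_exp ht, Real.exp_neg, inv_le_iff_one_le_mul₀' (Real.exp_pos _)] at h
  rw [← ENNReal.ofReal_mul (Real.exp_pos _).le, ENNReal.one_le_ofReal]
  exact ⟨h.1, ENNReal.ofReal_le_ofReal h.2⟩

section AcceptanceProbability

variable {α : Type*} {p phat : α → ℝ≥0} {q : α → α → ℝ≥0}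

/-- The Metropolis–Hastings acceptance probability `α_MH = 1 ∧ r_MH`. -/
noncomputable def acceptMH (p : α → ℝ≥0) (q : α → α → ℝ≥0) (x y : α) : ℝ≥0∞ :=
  min 1 (rMH p q x y)

/-- The delayed-acceptance probability `α_DA = (1 ∧ r_1)(1 ∧ r_2)`. -/
noncomputable def acceptDA (p phat : α → ℝ≥0) (q : α → α → ℝ≥0) (x y : α) : ℝ≥0∞ :=
  min 1 (rDA₁ phat q x y) * min 1 (rDA₂ p phat x y)

theorem flowDensity_acceptMH (z : α × α) : flowDensity p q (acceptMH p q) z =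
    min ((p z.1 : ℝ≥0∞) * q z.1 z.2) ((p z.2 : ℝ≥0∞) * q z.2 z.1) :=
  mul_min_one_div (ENNReal.mul_ne_top ENNReal.coe_ne_top ENNReal.coe_ne_top) _

theorem flowDensity_acceptDA {z : α × α} (hz : phat z.1 = 0 → p z.1 = 0) :
    flowDensity p q (acceptDA p phat q) z =
      min ((phat z.1 : ℝ≥0∞) * q z.1 z.2) ((phat z.2 : ℝ≥0∞) * q z.2 z.1) *
        min ((p z.1 : ℝ≥0∞) / phat z.1) ((p z.2 : ℝ≥0∞) / phat z.2) := by
  have hcancel : (phat z.1 : ℝ≥0∞) * (p z.1 / phat z.1) = p z.1 :=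
    ENNReal.mul_div_cancel' (by exact_mod_cast hz) (by simp)
  have hfinite : (p z.1 : ℝ≥0∞) / phat z.1 ≠ ∞ := by
    rw [Ne, ENNReal.div_eq_top]
    simpa using fun h0 h => h0 (hz h)
  rw [← mul_min_one_div (ENNReal.mul_ne_top ENNReal.coe_ne_top ENNReal.coe_ne_top),
    ← mul_min_one_div hfinite, flowDensity]
  conv_lhs => rw [← hcancel]
  simp only [acceptDA, rDA₁, rDA₂]
  ring

theorem rMH_eq_mul {x y : α} (hx : phat x ≠ 0) (hy : phat y ≠ 0) (hpx : p x ≠ 0)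
    (hqxy : q x y ≠ 0) : rMH p q x y = rDA₁ phat q x y * rDA₂ p phat x y := by
  have h : p y * q y x / (p x * q x y) =
      phat y * q y x / (phat x * q x y) * (p y / phat y / (p x / phat x)) := by
    field_simp
  have h2 := congrArg ((↑) : ℝ≥0 → ℝ≥0∞) h
  rw [ENNReal.coe_mul, ENNReal.coe_div (mul_ne_zero hpx hqxy),
    ENNReal.coe_div (mul_ne_zero hx hqxy), ENNReal.coe_div (div_ne_zero hpx hx),
    ENNReal.coe_div hx, ENNReal.coe_div hy] at h2
  simpa only [rMH, rDA₁, rDA₂, ENNReal.coe_mul] using h2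

theorem acceptMH_le_acceptDA {x y : α} (hx : phat x ≠ 0) (hy : phat y ≠ 0) (hpx : p x ≠ 0)
    (hqxy : q x y ≠ 0) {M : ℝ≥0}
    (h : y ∈ noProblemSet p phat q x ∨ logErrorDiscrepancy p phat x y ≤ M) :
    acceptMH p q x y ≤ ENNReal.ofReal (Real.exp M) * acceptDA p phat q x y := by
  have hL : 1 ≤ ENNReal.ofReal (Real.exp M) :=
    ENNReal.one_le_ofReal.2 (Real.one_le_exp M.coe_nonneg)
  rw [acceptMH, acceptDA, rMH_eq_mul hx hy hpx hqxy]
  rcases h with hsign | hM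
  · have hside := nonpos_or_nonneg_of_sign_mul_sign_nonneg hsign
    simp only [ENNReal.log_le_zero_iff, ENNReal.zero_le_log_iff] at hside
    rw [min_one_mul_min_one hside]
    exact le_mul_of_one_le_left' hL
  · have hbounds := bounds_of_abs_log_le hM
    exact min_one_mul_le_mul_min_one hL hbounds.1 hbounds.2

theorem flowDensity_acceptMH_le {z : α × α} (hz₁ : phat z.1 = 0 → p z.1 = 0)
    (hz₂ : phat z.2 = 0 → p z.2 = 0) {M : ℝ≥0} (h : p z.1 ≠ 0 → q z.1 z.2 ≠ 0 →
      z.2 ∈ noProblemSet p phat q z.1 ∨ logErrorDiscrepancy p phat z.1 z.2 ≤ M) :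
    flowDensity p q (acceptMH p q) z ≤
      ENNReal.ofReal (Real.exp M) * flowDensity p q (acceptDA p phat q) z := by
  by_cases hpos : p z.1 ≠ 0 ∧ q z.1 z.2 ≠ 0 ∧ p z.2 ≠ 0
  · obtain ⟨hp₁, hq₁₂, hp₂⟩ := hpos
    rw [flowDensity, flowDensity, mul_left_comm]
    gcongr
    exact acceptMH_le_acceptDA (mt hz₁ hp₁) (mt hz₂ hp₂) hp₁ hq₁₂ (h hp₁ hq₁₂)
  · have hzero : flowDensity p q (acceptMH p q) z = 0 := by
      rw [flowDensity_acceptMH]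
      simp only [ne_eq, not_and_or, not_not] at hpos
      rcases hpos with h0 | h0 | h0 <;> simp [h0]
    rw [hzero]
    exact zero_le

variable [MeasurableSpace α] {vol : Measure α}

theorem isBalancedAcceptance_acceptMH (hp : Measurable p) (hq : Measurable (Function.uncurry q)) :
    IsBalancedAcceptance vol p q (acceptMH p q) where
  measurable := by
    unfold acceptMH rMH Function.uncurry
    fun_prop
  le_one _ _ := min_le_left _ _
  flowDensity_swap := .of_forall fun z => by
    rw [flowDensity_acceptMH, flowDensity_acceptMH, min_comm, Prod.fst_swap, Prod.snd_swap]

theorem isBalancedAcceptance_acceptDA [SFinite vol] (hp : Measurable p) (hphat : Measurable phat)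
    (hq : Measurable (Function.uncurry q)) (hsupp : ∀ᵐ x ∂vol, phat x = 0 → p x = 0) :
    IsBalancedAcceptance vol p q (acceptDA p phat q) where
  measurable := by
    unfold acceptDA rDA₁ rDA₂ Function.uncurry
    fun_prop
  le_one _ _ := mul_le_one' (min_le_left _ _) (min_le_left _ _)
  flowDensity_swap := by
    filter_upwards [Measure.quasiMeasurePreserving_fst.ae hsupp,
      Measure.quasiMeasurePreserving_snd.ae hsupp] with z h₁ h₂
    rw [flowDensity_acceptDA h₁, flowDensity_acceptDA (z := z.swap) h₂, Prod.fst_swap,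
      Prod.snd_swap, min_comm, min_comm (_ / _)]

theorem ae_eq_zero_of_ae_withDensity_pos (hp : Measurable p)
    (hphat : ∀ᵐ x ∂(vol.withDensity fun x => (p x : ℝ≥0∞)), 0 < phat x) :
    ∀ᵐ x ∂vol, phat x = 0 → p x = 0 := by
  rw [ae_withDensity_iff hp.coe_nnreal_ennreal] at hphat
  filter_upwards [hphat] with x hx h0
  by_contra hpx
  exact (hx (by exact_mod_cast hpx)).ne' h0

theorem dominatedUpToRareMoves_acceptMH_acceptDA [SFinite vol] (hp : Measurable p)
    (hq : Measurable (Function.uncurry q)) (hphat : Measurable phat)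
    (hsupp : ∀ᵐ x ∂vol, phat x = 0 → p x = 0) {δ : α → α → ℝ≥0}
    (hδ : Measurable fun z : α × α => δ z.1 z.2) (hδ_comm : ∀ x y, δ x y = δ y x)
    (hq_local : ∀ ε : ℝ≥0∞, 0 < ε → ∃ r : ℝ≥0, ∀ x,
      ∫⁻ y in {y | δ x y < r}ᶜ, (q x y : ℝ≥0∞) ∂vol < ε)
    {h : ℝ≥0 → ℝ≥0} (hh : ∀ r, BddAbove (h '' Set.Icc 0 r))
    (hdiscrep : ∀ᵐ x ∂(vol.withDensity fun x => (p x : ℝ≥0∞)),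
      {y | 0 < q x y ∧ (h (δ x y) : ℝ≥0∞) < logErrorDiscrepancy p phat x y} ⊆
        noProblemSet p phat q x) :
    DominatedUpToRareMoves (vol.withDensity fun x => (p x : ℝ≥0∞))
      (acceptedFlow vol p q (acceptMH p q)) (acceptedFlow vol p q (acceptDA p phat q)) := by
  intro ε hε
  obtain ⟨r, hr⟩ := hq_local ε (by exact_mod_cast hε)
  obtain ⟨M, hM⟩ := hh r
  have hMH := isBalancedAcceptance_acceptMH (vol := vol) hp hq
  have hDA := isBalancedAcceptance_acceptDA hp hphat hq hsupp
  have hD : MeasurableSet {z : α × α | δ z.1 z.2 < r} := measurableSet_lt hδ measurable_const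
  refine ⟨{z | δ z.1 z.2 < r}, hD, ?_,
    fst_restrict_compl_acceptedFlow_le hp hq hMH.measurable hMH.le_one hD fun x => (hr x).le,
    (Real.exp M).toNNReal, restrict_acceptedFlow_le hp hq hDA.measurable hD ?_⟩
  · ext z
    simp only [Set.mem_preimage, Set.mem_ofPred_eq, Prod.fst_swap, Prod.snd_swap,
      hδ_comm z.2 z.1]
  · filter_upwards [Measure.quasiMeasurePreserving_fst.ae hsupp,
      Measure.quasiMeasurePreserving_snd.ae hsupp, Measure.quasiMeasurePreserving_fst.ae
        ((ae_withDensity_iff hp.coe_nnreal_ennreal).1 hdiscrep)] with z hz₁ hz₂ hsubset hz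
    refine flowDensity_acceptMH_le hz₁ hz₂ fun hpz hqz => ?_
    by_cases hlt : (h (δ z.1 z.2) : ℝ≥0∞) < logErrorDiscrepancy p phat z.1 z.2
    · exact .inl (hsubset (by exact_mod_cast hpz) ⟨pos_of_ne_zero hqz, hlt⟩)
    · refine .inr ((not_lt.1 hlt).trans ?_)
      exact_mod_cast hM ⟨_, ⟨zero_le, le_of_lt hz⟩, rfl⟩

end AcceptanceProbability

section StateSpace

variable {d : ℕ} {X : Set (EuclideanSpace ℝ (Fin d))}

theorem StateSpace.measurable_pt : Measurable (StateSpace.pt (X := X)) := fun s hs =>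
  ⟨s, hs.nullMeasurableSet, rfl⟩

theorem measurable_stateDist (N : Seminorm ℝ (EuclideanSpace ℝ (Fin d))) :
    Measurable fun z : StateSpace X × StateSpace X => stateDist N z.1 z.2 := by
  have hN : Continuous N := continuousOn_univ.1 (N.convexOn.continuousOn isOpen_univ)
  have h : Measurable fun z : StateSpace X × StateSpace X => N (z.2.pt - z.1.pt) :=
    hN.measurable.comp ((StateSpace.measurable_pt.comp measurable_snd).sub
      (StateSpace.measurable_pt.comp measurable_fst))
  exact h.subtype_mk

theorem stateDist_comm (N : Seminorm ℝ (EuclideanSpace ℝ (Fin d))) (x y : StateSpace X) :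
    stateDist N x y = stateDist N y x :=
  NNReal.eq (map_sub_rev N _ _)

end StateSpace

end DelayedAcceptance

open DelayedAcceptance in
theorem corollary3_general {α : Type*} [MeasurableSpace α] {vol : Measure α} [SFinite vol]
    {p phat : α → ℝ≥0} (hp : Measurable p) (hp_one : ∫⁻ x, (p x : ℝ≥0∞) ∂vol = 1)
    (hphat : Measurable phat)
    (hphat_pos : ∀ᵐ x ∂(vol.withDensity fun x => (p x : ℝ≥0∞)), 0 < phat x)
    {q : α → α → ℝ≥0} (hq : Measurable (Function.uncurry q))
    (hq_one : ∀ x, ∫⁻ y, (q x y : ℝ≥0∞) ∂vol = 1)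
    {δ : α → α → ℝ≥0} (hδ : Measurable fun z : α × α => δ z.1 z.2)
    (hδ_comm : ∀ x y, δ x y = δ y x)
    (hq_local : ∀ ε : ℝ≥0∞, 0 < ε → ∃ r : ℝ≥0, ∀ x,
      ∫⁻ y in {y | δ x y < r}ᶜ, (q x y : ℝ≥0∞) ∂vol < ε)
    {h : ℝ≥0 → ℝ≥0} (hh : ∀ r, BddAbove (h '' Set.Icc 0 r))
    (hdiscrep : ∀ᵐ x ∂(vol.withDensity fun x => (p x : ℝ≥0∞)),
      {y | 0 < q x y ∧ (h (δ x y) : ℝ≥0∞) < logErrorDiscrepancy p phat x y} ⊆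
        noProblemSet p phat q x)
    (hMH : VarianceBounding (mhKernel vol p q) (vol.withDensity fun x => (p x : ℝ≥0∞))) :
    VarianceBounding (daKernel vol p phat q) (vol.withDensity fun x => (p x : ℝ≥0∞)) := by
  have hsupp := ae_eq_zero_of_ae_withDensity_pos hp hphat_pos
  have hbalMH := isBalancedAcceptance_acceptMH (vol := vol) hp hq
  have hbalDA := isBalancedAcceptance_acceptDA hp hphat hq hsupp
  have : IsFiniteMeasure (vol.withDensity fun x => (p x : ℝ≥0∞)) :=
    isFiniteMeasure_withDensity (by simp [hp_one])
  refine (hbalDA.varianceBounding_parKernel_iff hp hp_one hq hq_one).2 ?_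
  exact ((hbalMH.varianceBounding_parKernel_iff hp hp_one hq hq_one).1
    hMH).of_dominatedUpToRareMoves (hbalMH.measurePreserving_swap_acceptedFlow hp hq)
    (dominatedUpToRareMoves_acceptMH_acceptDA hp hq hphat hsupp hδ hδ_comm hq_local hh hdiscrep)

theorem corollary3 {d : ℕ}
    -- a norm on `ℝ^d`
    (N : Seminorm ℝ (EuclideanSpace ℝ (Fin d))) (hN : ∀ v, N v = 0 → v = 0)
    -- a Lebesgue-measurable state space
    (X : Set (EuclideanSpace ℝ (Fin d))) (hX : NullMeasurableSet X volume)
    -- the target density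
    (p : DelayedAcceptance.StateSpace X → ℝ≥0) (hp : Measurable p)
    (hp_one : ∫⁻ x, (p x : ℝ≥0∞) ∂(DelayedAcceptance.lebesgue X) = 1)
    -- the approximation, positive wherever (up to null sets) the target is
    (phat : DelayedAcceptance.StateSpace X → ℝ≥0) (hphat : Measurable phat)
    (hphat_pos : ∀ᵐ x ∂((DelayedAcceptance.lebesgue X).withDensity (fun x => (p x : ℝ≥0∞))),
      0 < phat x)
    -- the proposal density
    (q : DelayedAcceptance.StateSpace X → DelayedAcceptance.StateSpace X → ℝ≥0)
    (hq : Measurable (Function.uncurry q))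
    (hq_one : ∀ x, ∫⁻ y, (q x y : ℝ≥0∞) ∂(DelayedAcceptance.lebesgue X) = 1)
    (hq_local : DelayedAcceptance.IsLocal N q)
    -- the growth condition on the log-error discrepancy, for the states that can be proposed
    (h : ℝ≥0 → ℝ≥0) (hh : ∀ r, BddAbove (h '' Set.Icc 0 r))
    (hdiscrep : ∀ᵐ x ∂((DelayedAcceptance.lebesgue X).withDensity (fun x => (p x : ℝ≥0∞))),
      {y | 0 < q x y ∧ (h (DelayedAcceptance.stateDist N x y) : ℝ≥0∞) <
          DelayedAcceptance.logErrorDiscrepancy p phat x y} ⊆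
        DelayedAcceptance.noProblemSet p phat q x)
    (hMH : DelayedAcceptance.VarianceBounding
      (DelayedAcceptance.mhKernel (DelayedAcceptance.lebesgue X) p q)
      ((DelayedAcceptance.lebesgue X).withDensity (fun x => (p x : ℝ≥0∞)))) :
    DelayedAcceptance.VarianceBounding
      (DelayedAcceptance.daKernel (DelayedAcceptance.lebesgue X) p phat q)
      ((DelayedAcceptance.lebesgue X).withDensity (fun x => (p x : ℝ≥0∞))) :=
  corollary3_general hp hp_one hphat hphat_pos hq hq_one (DelayedAcceptance.measurable_stateDist N)
    (DelayedAcceptance.stateDist_comm N) hq_local hh hdiscrep hMH
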